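/- Let $K$ be an algebraically closed field of characteristic $0$. Let $K\langle\langle X\rangle\rangle=\bigcup_{m\ge 1}K((X^{1/m}))$ be the field of fractional power series (Puiseux series) over $K$, regarded as an extension of the field of rational functions $K(X)$ via $K(X)\subset K((X))$, and let $K\langle\langle X\rangle\rangle^{alg}\subset K\langle\langle X\rangle\rangle$ be the subfield of all elements that are algebraic over $K(X)$. For $\alpha,\beta\in K\langle\langle X\rangle\rangle$ write $\alpha\mathrel{\#}\beta$ ($\alpha$ and $\beta$ are apart) if for some $q\in\mathbb{Q}$ the coefficients of $X^q$ in $\alpha$ and in $\beta$ are different. Then: 1. $K\langle\langle X\rangle\rangle^{alg}$ is a discrete field: it is a non-trivial ring in which every element is $0$ or invertible, and for all $\alpha,\beta\in K\langle\langle X\rangle\rangle^{alg}$ one has $\alpha\mathrel{\#}\beta$ or $\alpha=\beta$. Moreover apartness is decided by coefficients of bounded exponent: for all non-zero polynomials $P,Q\in K(X)[Y]$ there is $d\in\mathbb{N}$ such that, for all $\alpha,\beta\in K\langle\langle X\rangle\rangle^{alg}$ with $P(\alpha)=0$ and $Q(\beta)=0$, $\alpha\mathrel{\#}\beta$ holds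 if and only if the coefficients of $X^q$ in $\alpha$ and in $\beta$ are different for some rational $q\le d$. 2. $K\langle\langle X\rangle\rangle^{alg}$ is algebraically closed. -/

import Mathlib

/-- The additive map `n ↦ n / m` from `ℤ` to `ℚ`. -/
noncomputable def divExponent (m : ℕ) : ℤ →+ ℚ where
  toFun n := (n : ℚ) / m
  map_zero' := by simp
  map_add' a b := by push_cast; ring

theorem divExponent_le_iff (m : ℕ) (hm : 0 < m) (a b : ℤ) :
    divExponent m a ≤ divExponent m b ↔ a ≤ b := by
  have h : (0 : ℚ) < m := by exact_mod_cast hm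
  change (a : ℚ) / m ≤ (b : ℚ) / m ↔ a ≤ b
  rw [div_le_div_iff_of_pos_right h]
  exact Int.cast_le

theorem divExponent_injective (m : ℕ) (hm : 0 < m) :
    Function.Injective (divExponent m) := fun a b h =>
  le_antisymm ((divExponent_le_iff m hm a b).1 h.le) ((divExponent_le_iff m hm b a).1 h.ge)

/-- The substitution `X ↦ X ^ (1 / m)`, sending the Laurent series `∑ aₙ Xⁿ` to
`∑ aₙ X ^ (n / m)`, a series with exponents in `ℚ`. -/
noncomputable def rootSubst (K : Type*) [Field K] (m : ℕ) (hm : 0 < m) :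
    LaurentSeries K →+* HahnSeries ℚ K :=
  HahnSeries.embDomainRingHom (divExponent m) (divExponent_injective m hm)
    (divExponent_le_iff m hm)

theorem rootSubst_coeff (K : Type*) [Field K] (m : ℕ) (hm : 0 < m) (f : LaurentSeries K)
    (n : ℤ) : (rootSubst K m hm f).coeff ((n : ℚ) / m) = f.coeff n :=
  HahnSeries.embDomain_coeff
    (f := ⟨⟨divExponent m, divExponent_injective m hm⟩, divExponent_le_iff m hm _ _⟩)

/-- The field `K((X^{1/m}))`, inside the field of Hahn series with exponents in `ℚ`. -/
noncomputable def laurentRoot (K : Type*) [Field K] (m : ℕ) (hm : 0 < m) :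
    Subfield (HahnSeries ℚ K) :=
  (rootSubst K m hm).fieldRange

/-- `K((X^{1/m})) ⊆ K((X^{1/(mk)}))`. -/
theorem laurentRoot_le_mul (K : Type*) [Field K] (m k : ℕ) (hm : 0 < m) (hk : 0 < k) :
    laurentRoot K m hm ≤ laurentRoot K (m * k) (Nat.mul_pos hm hk) := by
  rintro _ ⟨f, rfl⟩
  have hk' : (0 : ℤ) < k := by exact_mod_cast hk
  have hle : ∀ a b : ℤ, (AddMonoidHom.mulRight (k : ℤ)) a ≤ (AddMonoidHom.mulRight (k : ℤ)) b ↔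
      a ≤ b := fun a b => by
    simp only [AddMonoidHom.coe_mulRight]
    exact mul_le_mul_iff_left₀ hk'
  have hinj : Function.Injective (AddMonoidHom.mulRight (k : ℤ)) := fun a b h =>
    le_antisymm ((hle a b).1 h.le) ((hle b a).1 h.ge)
  refine ⟨HahnSeries.embDomainRingHom (AddMonoidHom.mulRight (k : ℤ)) hinj hle f, ?_⟩
  ext q
  by_cases hq : ∃ n : ℤ, (n : ℚ) / m = q
  · obtain ⟨n, rfl⟩ := hq
    have e : (n : ℚ) / m = ((n * k : ℤ) : ℚ) / ((m * k : ℕ) : ℚ) := by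
      have : (k : ℚ) ≠ 0 := by exact_mod_cast hk.ne'
      push_cast
      rw [mul_div_mul_right _ _ this]
    rw [rootSubst_coeff]
    rw [e, rootSubst_coeff]
    exact HahnSeries.embDomain_coeff
      (f := ⟨⟨AddMonoidHom.mulRight (k : ℤ), hinj⟩, hle _ _⟩)
  · have h2 : (rootSubst K m hm f).coeff q = 0 := by
      refine HahnSeries.embDomain_of_notMem_range ?_
      rintro ⟨n, hn⟩
      exact hq ⟨n, hn⟩
    rw [h2]
    by_cases hq' : ∃ n : ℤ, (n : ℚ) / ((m * k : ℕ) : ℚ) = q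
    · obtain ⟨n, rfl⟩ := hq'
      rw [rootSubst_coeff]
      refine HahnSeries.embDomain_of_notMem_range ?_
      rintro ⟨j, hj⟩
      refine hq ⟨j, ?_⟩
      have hj' : j * (k : ℤ) = n := hj
      have : (k : ℚ) ≠ 0 := by exact_mod_cast hk.ne'
      rw [← hj']
      push_cast
      rw [mul_div_mul_right _ _ this]
    · refine HahnSeries.embDomain_of_notMem_range ?_
      rintro ⟨n, hn⟩
      exact hq' ⟨n, hn⟩

theorem laurentRoot_common (K : Type*) [Field K] {f g : HahnSeries ℚ K}
    (hf : ∃ (m : ℕ) (hm : 0 < m), f ∈ laurentRoot K m hm)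
    (hg : ∃ (m : ℕ) (hm : 0 < m), g ∈ laurentRoot K m hm) :
    ∃ (m : ℕ) (hm : 0 < m), f ∈ laurentRoot K m hm ∧ g ∈ laurentRoot K m hm := by
  obtain ⟨m, hm, hf⟩ := hf
  obtain ⟨n, hn, hg⟩ := hg
  refine ⟨m * n, Nat.mul_pos hm hn, laurentRoot_le_mul K m n hm hn hf, ?_⟩
  have h := laurentRoot_le_mul K n m hn hm hg
  simpa only [Nat.mul_comm n m] using h

/-- The field of fractional power series (Puiseux series) `⋃ₘ K((X^{1/m}))`, `m ≥ 1`. -/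
noncomputable def fracSeries (K : Type*) [Field K] : Subfield (HahnSeries ℚ K) where
  carrier := {f | ∃ (m : ℕ) (hm : 0 < m), f ∈ laurentRoot K m hm}
  zero_mem' := ⟨1, one_pos, zero_mem _⟩
  one_mem' := ⟨1, one_pos, one_mem _⟩
  add_mem' hf hg :=
    let ⟨m, hm, h1, h2⟩ := laurentRoot_common K hf hg
    ⟨m, hm, add_mem h1 h2⟩
  mul_mem' hf hg :=
    let ⟨m, hm, h1, h2⟩ := laurentRoot_common K hf hg
    ⟨m, hm, mul_mem h1 h2⟩
  neg_mem' := fun ⟨m, hm, h⟩ => ⟨m, hm, neg_mem h⟩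
  inv_mem' := fun _ ⟨m, hm, h⟩ => ⟨m, hm, inv_mem h⟩

/-- The embedding of `K((X)) = K((X^{1/1}))` into the field of fractional power series. -/
noncomputable def laurentToFracSeries (K : Type*) [Field K] :
    LaurentSeries K →+* fracSeries K :=
  (rootSubst K 1 one_pos).codRestrict (fracSeries K) fun f => ⟨1, one_pos, f, rfl⟩

open scoped RatFunc in
/-- The field of fractional power series as an extension of `K(X)`, through
`K(X) → K((X))`. -/
noncomputable instance fracSeriesAlgebra (K : Type*) [Field K] :
    Algebra (RatFunc K) (fracSeries K) :=
  ((laurentToFracSeries K).comp (algebraMap (RatFunc K) (LaurentSeries K))).toAlgebra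

/-- The subfield of all fractional power series that are algebraic over `K(X)`. -/
noncomputable def fracSeriesAlg (K : Type*) [Field K] :
    IntermediateField (RatFunc K) (fracSeries K) :=
  algebraicClosure (RatFunc K) (fracSeries K)

/-- The coefficient of `X ^ q` in a fractional power series. -/
noncomputable def fracCoeff {K : Type*} [Field K] (α : fracSeries K) (q : ℚ) : K :=
  (α : HahnSeries ℚ K).coeff q

/-- Apartness of fractional power series: some coefficient is different. -/
def FracApart {K : Type*} [Field K] (α β : fracSeries K) : Prop :=
  ∃ q : ℚ, fracCoeff α q ≠ fracCoeff β q

/-- A discrete field: a nontrivial commutative ring in which every element is zero or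
invertible. -/
def IsDiscreteField (R : Type*) [CommRing R] : Prop :=
  Nontrivial R ∧ ∀ x : R, x = 0 ∨ IsUnit x

/-! Everything rests on Puiseux's theorem, that `fracSeries K` is algebraically closed. Then its
subfield of elements algebraic over K(X) is algebraically closed too. Since P and Q have finitely
many roots, only finitely many pairs must be told apart, and one bound serves them all.

Puiseux's theorem goes by strong induction on the degree n of a monic p. A translation kills the
term of degree n - 1 (characteristic 0). If p is not Y^n, a Newton polygon scaling makes the
coefficients integral and some lower one a unit, and with T = X^(1/m) the polynomial lives over
K⟦T⟧. Its reduction is neither Y^n nor, lacking the next term, any (Y - c)^n. So a root c of the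
reduction has multiplicity below n, and Weierstrass preparation at c splits off a proper factor,
which has a root by induction. -/

open Polynomial in
/-- Over a complete local ring, a polynomial whose reduction has a zero of order between `1` and
`i` at the origin has a monic factor of degree between `1` and `i`. -/
theorem Polynomial.exists_monic_dvd_of_coeff_notMem {A : Type*} [CommRing A] [IsLocalRing A]
    [IsAdicComplete (IsLocalRing.maximalIdeal A) A] (f : A[X]) (i : ℕ)
    (h0 : f.coeff 0 ∈ IsLocalRing.maximalIdeal A) (hi : f.coeff i ∉ IsLocalRing.maximalIdeal A) :
    ∃ g : A[X], g.Monic ∧ g ∣ f ∧ 0 < g.natDegree ∧ g.natDegree ≤ i := by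
  have hne : PowerSeries.coeff i ((f : PowerSeries A).map (IsLocalRing.residue A)) ≠ 0 := by
    simpa [IsLocalRing.residue_eq_zero_iff] using hi
  have hmap : (f : PowerSeries A).map (IsLocalRing.residue A) ≠ 0 := fun h => hne (by simp [h])
  obtain ⟨g, h, H⟩ := PowerSeries.exists_isWeierstrassFactorization hmap
  have hdeg := H.natDegree_eq_toNat_order_map
  have htop : ((f : PowerSeries A).map (IsLocalRing.residue A)).order ≠ ⊤ := by
    simpa [PowerSeries.order_eq_top] using hmap
  have hmon := H.isDistinguishedAt.monic
  refine ⟨g, hmon, ?_, ?_, ?_⟩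
  -- The cofactor `h` is only a power series. Comparing `f = g * h` with polynomial division by `g`,
  -- uniqueness of Weierstrass division forces the remainder to vanish.
  · rw [← modByMonic_eq_zero_iff_dvd hmon]
    have hI : IsLocalRing.maximalIdeal A ≠ ⊤ := Ideal.IsMaximal.ne_top inferInstance
    have hord := H.isDistinguishedAt.coe_natDegree_eq_order_map g 1
      (by rwa [map_one, ← Ideal.ne_top_iff_one]) (by simp)
    refine ((H.isDistinguishedAt.isWeierstrassDivisorAt hI).eq_zero_of_mul_eq
      (q := h - (f /ₘ g : A[X])) ?_ ?_).2
    · rw [← hord, ENat.toNat_natCast, ← degree_eq_natDegree hmon.ne_zero]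
      exact degree_modByMonic_lt f hmon
    · rw [mul_sub, ← H.eq_mul, sub_eq_iff_eq_add, ← coe_mul, ← coe_add, modByMonic_add_div]
  · rw [hdeg, Nat.pos_iff_ne_zero, Ne, ENat.toNat_eq_zero, not_or]
    refine ⟨fun h => ?_, htop⟩
    have := PowerSeries.coeff_order hmap
    rw [h] at this
    simp only [ENat.toNat_zero, PowerSeries.coeff_map, coeff_coe, ne_eq,
      IsLocalRing.residue_eq_zero_iff] at this
    exact this h0
  · rw [hdeg]
    exact ENat.toNat_le_of_le_natCast (PowerSeries.order_le i hne)

instance PowerSeries.isAdicComplete_maximalIdeal {K : Type*} [Field K] :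
    IsAdicComplete (IsLocalRing.maximalIdeal (PowerSeries K)) (PowerSeries K) := by
  rw [PowerSeries.maximalIdeal_eq_span_X]
  infer_instance

theorem PowerSeries.mem_maximalIdeal_iff {K : Type*} [Field K] (f : PowerSeries K) :
    f ∈ IsLocalRing.maximalIdeal (PowerSeries K) ↔ constantCoeff f = 0 := by
  rw [PowerSeries.maximalIdeal_eq_span_X, Ideal.mem_span_singleton, PowerSeries.X_dvd_iff]

open Polynomial in
/-- A monic polynomial of degree `n` over `K⟦T⟧` without term of degree `n - 1` whose reduction is
not `Y ^ n` has a non-trivial monic factor. -/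
theorem PowerSeries.exists_monic_dvd_of_nextCoeff_eq_zero {K : Type*} [Field K] [IsAlgClosed K]
    [CharZero K] (Q : (PowerSeries K)[X]) (hQ : Q.Monic) (hnext : Q.nextCoeff = 0) {i : ℕ}
    (hi : i < Q.natDegree) (hi0 : constantCoeff (Q.coeff i) ≠ 0) :
    ∃ g : (PowerSeries K)[X], g.Monic ∧ g ∣ Q ∧ 0 < g.natDegree ∧
      g.natDegree < Q.natDegree := by
  have hQb : (Q.map constantCoeff).Monic := hQ.map _
  have hdeg : (Q.map constantCoeff).natDegree = Q.natDegree := hQ.natDegree_map _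
  obtain ⟨c, hc⟩ := IsAlgClosed.exists_root (Q.map constantCoeff) (by
    rw [degree_eq_natDegree hQb.ne_zero, hdeg]
    exact_mod_cast (by omega : Q.natDegree ≠ 0))
  have hmap : (taylor (C c) Q).map constantCoeff = taylor c (Q.map constantCoeff) := by
    simp [taylor_apply, Polynomial.map_comp]
  -- Otherwise the reduction is (Y - c)^n with next coefficient -nc = 0, so c = 0, contradicting
  -- `hi0`.
  obtain ⟨j, hj, hj0⟩ : ∃ j < Q.natDegree, constantCoeff ((taylor (C c) Q).coeff j) ≠ 0 := by
    by_contra! hall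
    have hX : taylor c (Q.map constantCoeff) = Polynomial.X ^ Q.natDegree := by
      rw [← hmap]
      ext j
      rw [Polynomial.coeff_map, Polynomial.coeff_X_pow]
      rcases lt_trichotomy j Q.natDegree with h | h | h
      · rw [hall j h, if_neg h.ne]
      · subst h
        simp [coeff_taylor_natDegree, hQ.leadingCoeff]
      · rw [if_neg h.ne', coeff_eq_zero_of_natDegree_lt (by rwa [natDegree_taylor]), map_zero]
    have hpow : Q.map constantCoeff = (Polynomial.X - Polynomial.C c) ^ Q.natDegree := by
      have := congrArg (taylor (-c)) hX
      rw [taylor_taylor, neg_add_cancel, taylor_zero] at this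
      rw [this]
      simp [taylor_apply, sub_eq_add_neg]
    have h1 : (Q.map constantCoeff).nextCoeff = 0 := by
      rw [nextCoeff_of_natDegree_pos (by omega), hdeg, Polynomial.coeff_map,
        ← nextCoeff_of_natDegree_pos (by omega), hnext, map_zero]
    rw [hpow, (monic_X_sub_C c).nextCoeff_pow, nextCoeff_X_sub_C] at h1
    have hc0 : c = 0 := by
      have : (Q.natDegree : K) ≠ 0 := by exact_mod_cast (by omega : Q.natDegree ≠ 0)
      simpa [this] using h1
    apply hi0
    rw [← Polynomial.coeff_map, hpow, hc0]
    simp [Polynomial.coeff_X_pow, hi.ne]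
  obtain ⟨g, hg, ⟨h, hgh⟩, hpos, hle⟩ :=
    Polynomial.exists_monic_dvd_of_coeff_notMem (taylor (C c) Q) j
    (by
      rw [mem_maximalIdeal_iff, ← Polynomial.coeff_map, hmap, taylor_coeff_zero]
      exact hc)
    (by rwa [mem_maximalIdeal_iff])
  refine ⟨taylor (-C c) g, ?_, ⟨taylor (-C c) h, ?_⟩, ?_, ?_⟩
  · rw [Monic, leadingCoeff, natDegree_taylor, coeff_taylor_natDegree, hg.leadingCoeff]
  · rw [← taylor_mul, ← hgh, taylor_taylor, neg_add_cancel, taylor_zero]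
  · rwa [natDegree_taylor]
  · rw [natDegree_taylor]; omega

open Polynomial in
/-- Tschirnhaus transformation. -/
theorem Polynomial.exists_nextCoeff_taylor_eq_zero {F : Type*} [Field F] [CharZero F] (p : F[X])
    (hp : p.Monic) (hpos : 0 < p.natDegree) : ∃ r : F, (taylor r p).nextCoeff = 0 := by
  -- The coefficient of degree n - 1 of p(Y + r) is this Hasse derivative at r, a linear polynomial
  -- with leading coefficient n.
  have h1 : (hasseDeriv (p.natDegree - 1) p).coeff 1 = p.natDegree := by
    rw [hasseDeriv_coeff, show 1 + (p.natDegree - 1) = p.natDegree by omega, hp.coeff_natDegree,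
      mul_one, ← Nat.choose_symm (by omega), show p.natDegree - (p.natDegree - 1) = 1 by omega,
      Nat.choose_one_right]
  have hne : (p.natDegree : F) ≠ 0 := by exact_mod_cast hpos.ne'
  obtain ⟨r, hr⟩ := exists_root_of_degree_eq_one (p := hasseDeriv (p.natDegree - 1) p) (by
    refine (degree_eq_iff_natDegree_eq_of_pos one_pos).2 ?_
    refine le_antisymm ((natDegree_hasseDeriv_le _ _).trans (by omega)) ?_
    exact le_natDegree_of_ne_zero (by rwa [h1]))
  refine ⟨r, ?_⟩
  rw [nextCoeff_of_natDegree_pos (by rwa [natDegree_taylor]), natDegree_taylor, taylor_coeff]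
  exact hr

/-! ### Puiseux's theorem: reduction to power series -/

section
variable {K : Type*} [Field K]

/-- The embedding `g(T) ↦ g(X ^ (1 / m))` of `K⟦T⟧` into the fractional power series. -/
noncomputable def powerSeriesRootSubst (K : Type*) [Field K] (m : ℕ) (hm : 0 < m) :
    PowerSeries K →+* fracSeries K :=
  ((rootSubst K m hm).comp (HahnSeries.ofPowerSeries ℤ K)).codRestrict (fracSeries K)
    fun _ => ⟨m, hm, _, rfl⟩

theorem powerSeriesRootSubst_injective {m : ℕ} (hm : 0 < m) :
    Function.Injective (powerSeriesRootSubst K m hm) := fun _ _ h =>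
  HahnSeries.ofPowerSeries_injective
    ((rootSubst K m hm).injective (congrArg Subtype.val h))

theorem exists_powerSeriesRootSubst_eq {m : ℕ} (hm : 0 < m) (x : fracSeries K)
    (hx : (x : HahnSeries ℚ K) ∈ laurentRoot K m hm) (hneg : ∀ q < 0, fracCoeff x q = 0) :
    ∃ g : PowerSeries K, powerSeriesRootSubst K m hm g = x := by
  obtain ⟨F, hF⟩ := hx
  refine ⟨PowerSeries.mk fun n => F.coeff n, Subtype.ext ?_⟩
  rw [← hF]
  refine congrArg (rootSubst K m hm) ?_
  ext n
  rcases lt_or_ge n 0 with hn | hn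
  · have hm' : (0 : ℚ) < m := by exact_mod_cast hm
    rw [← rootSubst_coeff K m hm F n, hF]
    refine Eq.trans ?_ (hneg _ (div_neg_of_neg_of_pos (by exact_mod_cast hn) hm')).symm
    rw [HahnSeries.ofPowerSeries_apply]
    refine HahnSeries.embDomain_of_notMem_range ?_
    rintro ⟨k, rfl⟩
    simp at hn
    omega
  · lift n to ℕ using hn
    rw [HahnSeries.ofPowerSeries_apply_coeff, PowerSeries.coeff_mk]

theorem fracCoeff_powerSeriesRootSubst_zero {m : ℕ} (hm : 0 < m) (g : PowerSeries K) :
    fracCoeff (powerSeriesRootSubst K m hm g) 0 = PowerSeries.constantCoeff g := by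
  have h := rootSubst_coeff K m hm (HahnSeries.ofPowerSeries ℤ K g) 0
  rw [Int.cast_zero, zero_div] at h
  refine h.trans ?_
  rw [← PowerSeries.coeff_zero_eq_constantCoeff_apply]
  exact HahnSeries.ofPowerSeries_apply_coeff g 0

/-- Finitely many fractional power series have a common denominator of exponents. -/
theorem exists_forall_mem_laurentRoot (s : Finset (fracSeries K)) :
    ∃ (m : ℕ) (hm : 0 < m), ∀ x ∈ s, (x : HahnSeries ℚ K) ∈ laurentRoot K m hm := by
  classical
  induction s using Finset.induction_on with
  | empty => exact ⟨1, one_pos, by simp⟩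
  | insert a s _ ih =>
    obtain ⟨m, hm, h⟩ := ih
    obtain ⟨n, hn, ha⟩ := a.2
    refine ⟨m * n, Nat.mul_pos hm hn, fun x hx => ?_⟩
    rcases Finset.mem_insert.1 hx with rfl | hx
    · have := laurentRoot_le_mul K n m hn hm ha
      simpa only [Nat.mul_comm n m] using this
    · exact laurentRoot_le_mul K m n hm hn (h x hx)

theorem single_mem_fracSeries (q : ℚ) (a : K) : HahnSeries.single q a ∈ fracSeries K := by
  refine ⟨q.den, q.den_pos, HahnSeries.single q.num a, ?_⟩
  refine HahnSeries.embDomain_single.trans ?_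
  congr 2
  exact Rat.num_div_den q

/-- The monomial `X ^ q`. -/
noncomputable def fracMonomial (K : Type*) [Field K] (q : ℚ) : fracSeries K :=
  ⟨HahnSeries.single q 1, single_mem_fracSeries q 1⟩

theorem fracMonomial_pow (q : ℚ) (n : ℕ) : fracMonomial K q ^ n = fracMonomial K (n * q) := by
  refine Subtype.ext ?_
  simp [fracMonomial, HahnSeries.single_pow]

theorem fracMonomial_ne_zero (q : ℚ) : fracMonomial K q ≠ 0 := by
  intro h
  exact HahnSeries.single_ne_zero one_ne_zero (congrArg Subtype.val h)

theorem fracCoeff_mul_fracMonomial (x : fracSeries K) (q r : ℚ) :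
    fracCoeff (x * fracMonomial K q) r = fracCoeff x (r - q) := by
  rw [mul_comm]
  refine HahnSeries.coeff_single_mul.trans ?_
  rw [one_mul]
  rfl

open Polynomial in
/-- The Newton polygon step: scaling the roots by a suitable power of `X` makes all coefficients
integral and some non-leading coefficient a unit. -/
theorem exists_scaleRoots_integral (p : (fracSeries K)[X]) (hp : p.Monic)
    (hne : ∃ i < p.natDegree, p.coeff i ≠ 0) :
    ∃ r : ℚ, (∀ i, ∀ q < 0, fracCoeff ((p.scaleRoots (fracMonomial K r)).coeff i) q = 0) ∧
      ∃ i < p.natDegree, fracCoeff ((p.scaleRoots (fracMonomial K r)).coeff i) 0 ≠ 0 := by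
  classical
  have hcoeff : ∀ r i q, fracCoeff ((p.scaleRoots (fracMonomial K r)).coeff i) q =
      fracCoeff (p.coeff i) (q - (p.natDegree - i : ℕ) * r) := fun r i q => by
    rw [coeff_scaleRoots, fracMonomial_pow, fracCoeff_mul_fracMonomial]
  set S := (Finset.range p.natDegree).filter fun i => p.coeff i ≠ 0 with hS
  obtain ⟨j, hj, hmin⟩ := S.exists_min_image
    (fun i => (p.coeff i : HahnSeries ℚ K).order / ((p.natDegree - i : ℕ) : ℚ)) (by
      obtain ⟨i, hi, hi0⟩ := hne
      exact ⟨i, by simp [hS, hi, hi0]⟩)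
  rw [hS, Finset.mem_filter, Finset.mem_range] at hj
  have hpos : ∀ i < p.natDegree, (0 : ℚ) < ((p.natDegree - i : ℕ) : ℚ) := fun i hi => by
    exact_mod_cast Nat.sub_pos_of_lt hi
  -- Scaling shifts the order of the i-th coefficient by (n - i)r. With -r the least slope
  -- ord(pᵢ)/(n - i), all orders become nonnegative, and the one at the minimiser `j` becomes 0.
  refine ⟨-((p.coeff j : HahnSeries ℚ K).order / ((p.natDegree - j : ℕ) : ℚ)), fun i q hq => ?_,
    j, hj.1, ?_⟩
  · rcases lt_trichotomy i p.natDegree with hi | rfl | hi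
    · by_cases h0 : p.coeff i = 0
      · rw [coeff_scaleRoots, h0, zero_mul]; rfl
      · rw [hcoeff]
        have := hmin i (by simp [hS, hi, h0])
        rw [le_div_iff₀ (hpos i hi)] at this
        refine HahnSeries.coeff_eq_zero_of_lt_order ?_
        linarith
    · rw [coeff_scaleRoots_natDegree, hp.leadingCoeff]
      exact HahnSeries.coeff_single_of_ne hq.ne
    · rw [coeff_eq_zero_of_natDegree_lt (by rwa [natDegree_scaleRoots])]
      rfl
  · rw [hcoeff, mul_neg, mul_div_cancel₀ _ (hpos j hj.1).ne', zero_sub, neg_neg]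
    refine fun h => hj.2 (Subtype.ext ?_)
    exact HahnSeries.coeff_order_eq_zero.1 h

theorem fracSeries_charZero [CharZero K] : CharZero (fracSeries K) :=
  charZero_of_injective_ringHom ((powerSeriesRootSubst K 1 one_pos).comp PowerSeries.C).injective

open Polynomial in
theorem exists_isRoot_fracSeries_of_nextCoeff_eq_zero [IsAlgClosed K] [CharZero K]
    (p : (fracSeries K)[X]) (hp : p.Monic) (hpos : 0 < p.natDegree) (hnext : p.nextCoeff = 0)
    (ih : ∀ g : (fracSeries K)[X], g.Monic → 0 < g.natDegree → g.natDegree < p.natDegree →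
      ∃ x, g.IsRoot x) : ∃ x, p.IsRoot x := by
  classical
  by_cases hne : ∃ i < p.natDegree, p.coeff i ≠ 0
  · obtain ⟨r, hint, i, hi, hi0⟩ := exists_scaleRoots_integral p hp hne
    set s := fracMonomial K r
    have hs : s ≠ 0 := fracMonomial_ne_zero r
    obtain ⟨m, hm, hmem⟩ := exists_forall_mem_laurentRoot
      ((Finset.range (p.natDegree + 1)).image (p.scaleRoots s).coeff)
    have hlift : p.scaleRoots s ∈ lifts (powerSeriesRootSubst K m hm) := by
      rw [lifts_iff_coeff_lifts]
      intro k
      rcases lt_or_ge p.natDegree k with hk | hk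
      · rw [coeff_eq_zero_of_natDegree_lt (by rwa [natDegree_scaleRoots])]
        exact ⟨0, map_zero _⟩
      · exact exists_powerSeriesRootSubst_eq hm _
          (hmem _ (Finset.mem_image_of_mem _ (by simpa [Nat.lt_succ_iff] using hk))) (hint k)
    obtain ⟨Q, hQ, hQdeg, hQmon⟩ :=
      lifts_and_natDegree_eq_and_monic hlift ((monic_scaleRoots_iff s).2 hp)
    rw [natDegree_scaleRoots] at hQdeg
    obtain ⟨g, hg, ⟨h, hgh⟩, hg0, hglt⟩ :=
      -- Scaling multiplies the next coefficient by `s`, so it stays zero.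
      PowerSeries.exists_monic_dvd_of_nextCoeff_eq_zero Q hQmon (i := i) (by
        refine powerSeriesRootSubst_injective hm ?_
        rw [nextCoeff_of_natDegree_pos (by omega), map_zero, ← coeff_map, hQ, coeff_scaleRoots,
          hQdeg, ← nextCoeff_of_natDegree_pos hpos, hnext, zero_mul]) (by omega) (by
        rw [← fracCoeff_powerSeriesRootSubst_zero hm, ← coeff_map, hQ]
        exact hi0)
    obtain ⟨x, hx⟩ := ih (g.map (powerSeriesRootSubst K m hm)) (hg.map _)
      (by rwa [hg.natDegree_map]) (by rw [hg.natDegree_map]; omega)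
    have hroot : (p.scaleRoots s).IsRoot x := by
      rw [← hQ, hgh, Polynomial.map_mul]
      exact root_mul_right_of_isRoot _ hx
    refine ⟨s⁻¹ * x, ?_⟩
    have h2 : ((p.scaleRoots s).scaleRoots s⁻¹).eval (s⁻¹ * x) = 0 :=
      scaleRoots_eval₂_eq_zero (RingHom.id _) hroot
    rwa [← scaleRoots_mul, mul_inv_cancel₀ hs, scaleRoots_one] at h2
  · push Not at hne
    refine ⟨0, ?_⟩
    rw [IsRoot, ← coeff_zero_eq_eval_zero]
    exact hne 0 hpos

/-- **Puiseux's theorem**. -/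
theorem isAlgClosed_fracSeries [IsAlgClosed K] [CharZero K] : IsAlgClosed (fracSeries K) := by
  have := fracSeries_charZero (K := K)
  have key : ∀ (n : ℕ) (p : Polynomial (fracSeries K)), p.natDegree = n → p.Monic →
      0 < p.natDegree → ∃ x, p.IsRoot x := by
    intro n
    induction n using Nat.strong_induction_on with
    | _ n ih =>
      intro p hn hp hpos
      obtain ⟨r, hr⟩ := p.exists_nextCoeff_taylor_eq_zero hp hpos
      obtain ⟨x, hx⟩ := exists_isRoot_fracSeries_of_nextCoeff_eq_zero (Polynomial.taylor r p)
        (by rw [Polynomial.Monic, Polynomial.leadingCoeff, Polynomial.natDegree_taylor,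
          Polynomial.coeff_taylor_natDegree, hp.leadingCoeff])
        (by rwa [Polynomial.natDegree_taylor]) hr
        (fun g hg hg0 hlt => ih g.natDegree
          (by rw [Polynomial.natDegree_taylor] at hlt; omega) g rfl hg hg0)
      refine ⟨x + r, ?_⟩
      rwa [Polynomial.IsRoot, Polynomial.taylor_eval] at hx
  exact IsAlgClosed.of_exists_root _ fun p hp hirr => key _ p rfl hp hirr.natDegree_pos

/-! ### Apartness and the main theorem -/

theorem fracApart_or_eq (α β : fracSeries K) : FracApart α β ∨ α = β := by
  by_cases h : FracApart α β
  · exact Or.inl h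
  · rw [FracApart, not_exists] at h
    exact Or.inr (Subtype.ext (HahnSeries.ext (funext fun q => not_not.1 (h q))))

/-- On finite sets of fractional power series, apartness is decided by the coefficients of bounded
exponent. -/
theorem exists_bound_fracApart {S T : Set (fracSeries K)} (hS : S.Finite) (hT : T.Finite) :
    ∃ d : ℕ, ∀ α ∈ S, ∀ β ∈ T, FracApart α β → ∃ q : ℚ, q ≤ d ∧ fracCoeff α q ≠ fracCoeff β q := by
  have h : ∀ x : fracSeries K × fracSeries K, ∃ d : ℕ,
      FracApart x.1 x.2 → ∃ q : ℚ, q ≤ d ∧ fracCoeff x.1 q ≠ fracCoeff x.2 q := fun x => by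
    by_cases hx : FracApart x.1 x.2
    · obtain ⟨q, hq⟩ := hx
      obtain ⟨d, hd⟩ := exists_nat_ge q
      exact ⟨d, fun _ => ⟨q, hd, hq⟩⟩
    -- For a pair that is not apart the condition is vacuous and any bound works.
    · exact ⟨0, fun h => absurd h hx⟩
  choose d hd using h
  obtain ⟨D, hD⟩ := ((hS.prod hT).image d).bddAbove
  refine ⟨D, fun α hα β hβ hαβ => ?_⟩
  obtain ⟨q, hq, hne⟩ := hd (α, β) hαβ
  exact ⟨q, hq.trans (by exact_mod_cast hD ⟨(α, β), ⟨hα, hβ⟩, rfl⟩), hne⟩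

end

theorem mainTheorem3 (K : Type*) [Field K] [IsAlgClosed K] [CharZero K] :
    -- every element is zero or invertible
    IsDiscreteField (fracSeriesAlg K) ∧
    -- apartness and equality are complementary alternatives on algebraic elements
    (∀ α β : fracSeriesAlg K, FracApart (α : fracSeries K) (β : fracSeries K) ∨ α = β) ∧
    -- apartness is decided by the coefficients up to an exponent that depends only on
    -- annihilating polynomials
    (∀ P Q : Polynomial (RatFunc K), P ≠ 0 → Q ≠ 0 → ∃ d : ℕ, ∀ α β : fracSeriesAlg K,
      Polynomial.aeval α P = 0 → Polynomial.aeval β Q = 0 →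
        (FracApart (α : fracSeries K) (β : fracSeries K) ↔
          ∃ q : ℚ, q ≤ d ∧ fracCoeff (α : fracSeries K) q ≠ fracCoeff (β : fracSeries K) q)) ∧
    IsAlgClosed (fracSeriesAlg K) := by
  have := isAlgClosed_fracSeries (K := K)
  refine ⟨⟨inferInstance, fun x => ?_⟩, fun α β => ?_, fun P Q hP hQ => ?_, ?_⟩
  · rw [isUnit_iff_ne_zero]
    exact eq_or_ne x 0
  · exact (fracApart_or_eq _ _).imp_right Subtype.ext
  · obtain ⟨d, hd⟩ := exists_bound_fracApart (P.rootSet_finite (fracSeries K))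
      (Q.rootSet_finite (fracSeries K))
    have hmem : ∀ (R : Polynomial (RatFunc K)) (γ : fracSeriesAlg K), R ≠ 0 →
        Polynomial.aeval γ R = 0 → (γ : fracSeries K) ∈ R.rootSet (fracSeries K) :=
      fun R γ hR hγ => Polynomial.mem_rootSet'.2 ⟨Polynomial.map_ne_zero hR, by
        rw [IntermediateField.aeval_coe, hγ, ZeroMemClass.coe_zero]⟩
    exact ⟨d, fun α β hα hβ => ⟨hd α (hmem P α hP hα) β (hmem Q β hQ hβ),
      fun ⟨q, _, hq⟩ => ⟨q, hq⟩⟩⟩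
  · exact (algebraicClosure.isAlgClosure (RatFunc K) (fracSeries K)).isAlgClosed
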